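/- **Theorem (exact recovery of pose-graph optimization from its sparse SDP relaxation under low noise).** Let $n\ge 1$, let $d$ be the dimension, and let $\mathcal G=([n],\mathcal E)$, $\mathcal E\subseteq[n]\times[n]$, be a weakly connected directed graph with weights $\kappa_{ij},\tau_{ij}>0$ for $(i,j)\in\mathcal E$. For relative measurements $(\widetilde R_{ij},\widetilde t_{ij})\in\mathrm{SO}(d)\times\mathbb R^d$, $(i,j)\in\mathcal E$, *pose-graph optimization* (PGO) is the problem $$\min_{R_i\in\mathrm{SO}(d),\;t_i\in\mathbb R^d}\ \sum_{(i,j)\in\mathcal E}\kappa_{ij}\,\|R_j-R_i\widetilde R_{ij}\|_F^2+\tau_{ij}\,\|t_j-t_i-R_i\widetilde t_{ij}\|_2^2 .$$ Let $Q\in\mathbb R^{(d+1)n\times(d+1)n}$ be the connection Laplacian of the measurements: the symmetric matrix of $(d+1)\times(d+1)$ blocks which is the sum over the edges $(i,j)\in\mathcal E$ of the contributions $\widetilde T_{ij}\Omega_{ij}\widetilde T_{ij}^{\top}$ to block $(i,i)$, $\Omega_{ij}$ to block $(j,j)$, $-\widetilde T_{ij}\Omega_{ij}$ to block $(i,j)$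 and $-\Omega_{ij}\widetilde T_{ij}^{\top}$ to block $(j,i)$, where $\widetilde T_{ij}=\begin{bmatrix}\widetilde R_{ij}&\widetilde t_{ij}\\0&1\end{bmatrix}$ and $\Omega_{ij}=\mathrm{diag}(\kappa_{ij}I_d,\tau_{ij})$. (Thus the PGO cost of $T=[R_1\ t_1\ \cdots\ R_n\ t_n]$ is $\langle Q,T^{\top}T\rangle$.) The *sparse SDP relaxation* is $$\min_{Z\succeq 0}\ \langle Q,Z\rangle\quad\text{subject to}\quad Z_{[i,i](1:d,1:d)}=I_d\ \text{ for all } i\in[n],$$ over symmetric $(d+1)n\times(d+1)n$ matrices $Z$, where $Z_{[i,i]}$ is the $i$-th diagonal $(d+1)\times(d+1)$ block. Let true poses $(\underline R_i,\underline t_i)\in\mathrm{SO}(d)\times\mathbb R^d$, $i\in[n]$, be given and let $\underline Q$ be the connection Laplacian, with the same graph and weights, of the true relative transformations $\underline R_{ij}=\underline R_i^{\top}\underline R_j$, $\underline t_{ij}=\underline R_i^{\top}(\underline t_j-\underline t_i)$. Then there is a constant $\delta>0$ such that for all measurements with $\|Q-\underline Q\|_2<\delta$ (spectral norm), the SDP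 relaxation has a minimizer, and every minimizer $Z^\star$ has first $d\times(d+1)n$ block row $$Z^\star_{(1:d,:)}=\begin{bmatrix}R_1^\star&t_1^\star&\cdots&R_n^\star&t_n^\star\end{bmatrix},$$ where $\{R_i^\star,t_i^\star\}$ is a globally optimal solution of PGO; moreover $\langle Q,Z^\star\rangle$ equals the optimal value of PGO, so the relaxation is exact. -/

import Mathlib

open scoped Matrix

/-- An element `(R, t)` of `SE(d)`: a rotation `R ∈ SO(d)` and a translation `t ∈ ℝᵈ`.
Used both for poses and for relative measurements. -/
structure Pose (d : ℕ) where
  rot : Matrix.specialOrthogonalGroup (Fin d) ℝ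
  trans : Fin d → ℝ

namespace Pose

/-- The rotation of a pose, as a `d × d` matrix. -/
def R {d : ℕ} (P : Pose d) : Matrix (Fin d) (Fin d) ℝ := P.rot.1

/-- The noiseless relative transformation from the pose `P` to the pose `P'`:
rotation `Rᵀ R'`, translation `Rᵀ (t' - t)`. -/
def rel {d : ℕ} (P P' : Pose d) : Pose d where
  rot := P.rot⁻¹ * P'.rot
  trans := P.Rᵀ *ᵥ (P'.trans - P.trans)

/-- The homogeneous matrix `[R t; 0 1]` of an element of `SE(d)`. -/
def homog {d : ℕ} (P : Pose d) : Matrix (Fin d ⊕ Unit) (Fin d ⊕ Unit) ℝ :=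
  Matrix.fromBlocks P.R (Matrix.replicateCol Unit P.trans) 0 1

end Pose

namespace PGO

/-- Index set of the rows and columns of `(d+1)n × (d+1)n` matrices with `(d+1) × (d+1)` blocks:
`(i, Sum.inl a)` is the `a`-th rotation column and `(i, Sum.inr ())` the translation column of the
`i`-th pose. -/
abbrev Idx (n d : ℕ) : Type := Fin n × (Fin d ⊕ Unit)

/-- Weak connectedness of the directed graph with vertex set `[n]` and edge set `E`. -/
def WeaklyConnected {n : ℕ} (E : Finset (Fin n × Fin n)) : Prop :=
  (SimpleGraph.fromRel fun i j : Fin n => (i, j) ∈ E).Connected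

/-- Squared Frobenius norm. -/
def frobSq {m k : ℕ} (A : Matrix (Fin m) (Fin k) ℝ) : ℝ := ∑ a, ∑ b, A a b ^ 2

/-- Squared Euclidean norm. -/
def normSq {m : ℕ} (v : Fin m → ℝ) : ℝ := ∑ a, v a ^ 2

/-- The cost of pose-graph optimization,
`∑_{(i,j) ∈ E} κᵢⱼ ‖Rⱼ - Rᵢ R̃ᵢⱼ‖_F² + τᵢⱼ ‖tⱼ - tᵢ - Rᵢ t̃ᵢⱼ‖₂²`,
for the relative measurements `meas i j = (R̃ᵢⱼ, t̃ᵢⱼ)`. -/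
def cost {n d : ℕ} (E : Finset (Fin n × Fin n)) (κ τ : Fin n → Fin n → ℝ)
    (meas : Fin n → Fin n → Pose d) (T : Fin n → Pose d) : ℝ :=
  ∑ e ∈ E,
    (κ e.1 e.2 * frobSq ((T e.2).R - (T e.1).R * (meas e.1 e.2).R) +
      τ e.1 e.2 *
        normSq ((T e.2).trans - (T e.1).trans - (T e.1).R *ᵥ (meas e.1 e.2).trans))

/-- `T = {Rᵢ, tᵢ}` is a (globally) optimal solution of pose-graph optimization. -/
def IsOptimal {n d : ℕ} (E : Finset (Fin n × Fin n)) (κ τ : Fin n → Fin n → ℝ)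
    (meas : Fin n → Fin n → Pose d) (T : Fin n → Pose d) : Prop :=
  ∀ T' : Fin n → Pose d, cost E κ τ meas T ≤ cost E κ τ meas T'

/-- The weight `diag(κ, …, κ, τ)` of one measurement. -/
def weight (d : ℕ) (κ τ : ℝ) : Matrix (Fin d ⊕ Unit) (Fin d ⊕ Unit) ℝ :=
  Matrix.diagonal (Sum.elim (fun _ => κ) (fun _ => τ))

/-- The `(d+1) × (d+1)` block in position `(i, j)` of the connection Laplacian. With `T̃` the
homogeneous matrix and `Ω` the weight of the measurement of an edge `(k, l)`, that edge contributes
`T̃ Ω T̃ᵀ` to block `(k, k)`, `Ω` to block `(l, l)`, `-T̃ Ω` to block `(k, l)` and `-Ω T̃ᵀ` to block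
`(l, k)`. -/
def lapBlock {n d : ℕ} (E : Finset (Fin n × Fin n)) (κ τ : Fin n → Fin n → ℝ)
    (meas : Fin n → Fin n → Pose d) (i j : Fin n) :
    Matrix (Fin d ⊕ Unit) (Fin d ⊕ Unit) ℝ :=
  ∑ e ∈ E,
    let H := (meas e.1 e.2).homog
    let Ω := weight d (κ e.1 e.2) (τ e.1 e.2)
    (if i = e.1 ∧ j = e.1 then H * Ω * Hᵀ else 0) + (if i = e.2 ∧ j = e.2 then Ω else 0)
      - (if i = e.1 ∧ j = e.2 then H * Ω else 0) - (if i = e.2 ∧ j = e.1 then Ω * Hᵀ else 0)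

/-- The connection Laplacian `Q` formed from the relative measurements `meas`. -/
def connLaplacian {n d : ℕ} (E : Finset (Fin n × Fin n)) (κ τ : Fin n → Fin n → ℝ)
    (meas : Fin n → Fin n → Pose d) : Matrix (Idx n d) (Idx n d) ℝ :=
  Matrix.of fun p q => lapBlock E κ τ meas p.1 q.1 p.2 q.2

/-- The spectral norm `‖A‖₂`: the operator norm with respect to the Euclidean norm. -/
noncomputable def specNorm {n d : ℕ} (A : Matrix (Idx n d) (Idx n d) ℝ) : ℝ :=
  ‖Matrix.toEuclideanCLM (n := Idx n d) (𝕜 := ℝ) A‖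

/-- The feasible set of the semidefinite relaxation: positive semidefinite (symmetric) `Z` whose
diagonal blocks satisfy `Z_[i,i](1:d,1:d) = I` for all `i`. -/
def sdpFeasible (n d : ℕ) : Set (Matrix (Idx n d) (Idx n d) ℝ) :=
  {Z | Z.PosSemidef ∧
    ∀ i : Fin n, Z.submatrix (fun a : Fin d => (i, Sum.inl a)) (fun b => (i, Sum.inl b)) = 1}

/-- The objective `⟨Q, Z⟩` of the semidefinite relaxation. -/
def sdpObj {n d : ℕ} (Q Z : Matrix (Idx n d) (Idx n d) ℝ) : ℝ := (Qᵀ * Z).trace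

/-- `Z` is a minimizer of the semidefinite relaxation with cost matrix `Q`. -/
def IsSDPMinimizer {n d : ℕ} (Q Z : Matrix (Idx n d) (Idx n d) ℝ) : Prop :=
  Z ∈ sdpFeasible n d ∧ IsMinOn (sdpObj Q) (sdpFeasible n d) Z

/-- The `d × (d+1)n` matrix `[R₁ t₁ ⋯ Rₙ tₙ]`. -/
def blockRow {n d : ℕ} (T : Fin n → Pose d) : Matrix (Fin d) (Idx n d) ℝ :=
  Matrix.of fun a p => Sum.elim (fun b => (T p.1).R a b) (fun _ => (T p.1).trans a) p.2

/-- The first `d` rows `Z_(1:d,:)` of `Z`. -/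
def firstRows {n d : ℕ} [NeZero n] (Z : Matrix (Idx n d) (Idx n d) ℝ) :
    Matrix (Fin d) (Idx n d) ℝ :=
  Z.submatrix (fun a => ((0 : Fin n), Sum.inl a)) id

end PGO

/-! The proof builds a dual certificate at a PGO optimum `T`. Write `X = blockRow T`. Stationarity
along `SO(d)` and in the translations says `X Q = X Λ`, with `Λ` block diagonal, symmetric, and zero
in the translation slots. Hence `S = Q - Λ` annihilates the rows of `X` and the translation
direction `transOnes`. Combinations of these vectors match any vector at pose `0`, so positivity of
`S` on vectors vanishing at pose `0` already gives `S ⪰ 0` and identifies its kernel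
(`posSemidef_of_annihilates`, `eq_anchored_of_mulVec_eq_zero`). On the feasible set `⟨Λ, Z⟩` is
constant, so `Xᵀ X` is a minimizer, and every minimizer satisfies `S Z = 0`. The first rows of such
a `Z` are then a rigid motion of `X`, again optimal (`exact_of_certificate`).

Positivity of `S` is where low noise enters. By connectivity the noiseless Laplacian is at least
some `c > 0` off pose `0`, and `Q` differs from it by `ε`. Moreover `‖Λ‖_F² ≤ ‖X Q‖_F² ≤ M · cost T
≤ M · cost truth ≤ M ε N`, where `M` bounds `Q` and `N` is the squared size of the true poses. No
closeness of `T` to the truth is needed. -/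

namespace PGO

/-! ### The connection Laplacian as a sum of edge Gram forms. -/

variable {n d : ℕ}

/-- The matrix of the linear map `x ↦ xⱼ - H(P)ᵀ xᵢ`. -/
def edgeDiff (P : Pose d) (i j : Fin n) : Matrix (Fin d ⊕ Unit) (Idx n d) ℝ :=
  Matrix.of fun c p => (if p.1 = j then (1 : Matrix _ _ ℝ) c p.2 else 0) -
    (if p.1 = i then P.homog p.2 c else 0)

theorem edgeDiff_mulVec (P : Pose d) (i j : Fin n) (x : Idx n d → ℝ) (c : Fin d ⊕ Unit) :
    (edgeDiff P i j *ᵥ x) c = x (j, c) - ∑ s, P.homog s c * x (i, s) := by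
  have h1 : ∑ p : Idx n d, (if p.1 = j then (1 : Matrix _ _ ℝ) c p.2 else 0) * x p
      = x (j, c) := by
    rw [Fintype.sum_prod_type, Finset.sum_eq_single j]
    · simp only [if_true, Matrix.one_apply, ite_mul, one_mul, zero_mul]
      rw [Finset.sum_ite_eq]; simp
    · intro b _ hb; simp [hb]
    · simp
  have h2 : ∑ p : Idx n d, (if p.1 = i then P.homog p.2 c else 0) * x p
      = ∑ s, P.homog s c * x (i, s) := by
    rw [Fintype.sum_prod_type, Finset.sum_eq_single i]
    · simp
    · intro b _ hb; simp [hb]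
    · simp
  simp only [Matrix.mulVec, dotProduct, edgeDiff, Matrix.of_apply, sub_mul,
    Finset.sum_sub_distrib, h1, h2]

theorem edgeDiff_mulVec_inl (P : Pose d) (i j : Fin n) (x : Idx n d → ℝ) (b : Fin d) :
    (edgeDiff P i j *ᵥ x) (Sum.inl b) =
      x (j, Sum.inl b) - ∑ s, P.R s b * x (i, Sum.inl s) := by
  rw [edgeDiff_mulVec]; simp [Pose.homog]

theorem edgeDiff_mulVec_inr (P : Pose d) (i j : Fin n) (x : Idx n d → ℝ) (u : Unit) :
    (edgeDiff P i j *ᵥ x) (Sum.inr u) =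
      x (j, Sum.inr ()) - x (i, Sum.inr ()) - ∑ s, P.trans s * x (i, Sum.inl s) := by
  rw [edgeDiff_mulVec]; simp [Pose.homog]; ring

variable (E : Finset (Fin n × Fin n)) (κ τ : Fin n → Fin n → ℝ) (meas : Fin n → Fin n → Pose d)

/-- The four block contributions of an edge are the expansion of `Dᵀ Ω D`, with `D` the edge
residual map. Positive semidefiniteness and the form as a weighted sum of squared residuals both
follow. -/
theorem connLaplacian_eq_sum :
    connLaplacian E κ τ meas = ∑ e ∈ E, (edgeDiff (meas e.1 e.2) e.1 e.2)ᵀ *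
      weight d (κ e.1 e.2) (τ e.1 e.2) * edgeDiff (meas e.1 e.2) e.1 e.2 := by
  ext ⟨i, p⟩ ⟨j, q⟩
  simp only [connLaplacian, Matrix.of_apply, lapBlock, Matrix.sum_apply]
  refine Finset.sum_congr rfl fun e _ => ?_
  set H := (meas e.1 e.2).homog
  set W := weight d (κ e.1 e.2) (τ e.1 e.2)
  have hD : ∀ k : Fin n, ∀ r, (fun c => edgeDiff (meas e.1 e.2) e.1 e.2 c (k, r)) =
      (if k = e.2 then (1 : Matrix _ _ ℝ) r else 0) - (if k = e.1 then H r else 0) := by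
    intro k r; ext c
    simp only [edgeDiff, Matrix.of_apply, Pi.sub_apply]
    congr 1 <;> split_ifs <;> simp [H, Matrix.one_apply, eq_comm]
  have hR : ((edgeDiff (meas e.1 e.2) e.1 e.2)ᵀ * W * edgeDiff (meas e.1 e.2) e.1 e.2)
      (i, p) (j, q) = (fun c => edgeDiff (meas e.1 e.2) e.1 e.2 c (i, p)) ᵥ* W ⬝ᵥ
        (fun c => edgeDiff (meas e.1 e.2) e.1 e.2 c (j, q)) := by
    simp [Matrix.mul_apply, Matrix.vecMul, dotProduct]
  rw [hR, hD, hD]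
  have a1 : (H * W * Hᵀ) p q = H p ᵥ* W ⬝ᵥ H q := by
    simp [Matrix.mul_apply, Matrix.vecMul, dotProduct]
  have a2 : W p q = (1 : Matrix _ _ ℝ) p ᵥ* W ⬝ᵥ (1 : Matrix _ _ ℝ) q := by
    have : W = 1 * W * 1ᵀ := by simp
    conv_lhs => rw [this]
    simp only [Matrix.mul_apply, Matrix.vecMul, dotProduct, Matrix.transpose_apply]
  have a3 : (H * W) p q = H p ᵥ* W ⬝ᵥ (1 : Matrix _ _ ℝ) q := by
    have : H * W = H * W * 1ᵀ := by simp
    conv_lhs => rw [this]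
    simp only [Matrix.mul_apply, Matrix.vecMul, dotProduct, Matrix.transpose_apply]
  have a4 : (W * Hᵀ) p q = (1 : Matrix _ _ ℝ) p ᵥ* W ⬝ᵥ H q := by
    have : W * Hᵀ = 1 * W * Hᵀ := by simp
    conv_lhs => rw [this]
    simp only [Matrix.mul_apply, Matrix.vecMul, dotProduct, Matrix.transpose_apply]
  simp only [Matrix.sub_apply, Matrix.add_apply, Matrix.sub_vecMul, sub_dotProduct,
    dotProduct_sub, apply_ite (fun M : Matrix (Fin d ⊕ Unit) (Fin d ⊕ Unit) ℝ => M p q),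
    Matrix.zero_apply, a1, a2, a3, a4]
  simp only [ite_and]
  split_ifs <;> (try simp only [Matrix.zero_vecMul, zero_dotProduct, dotProduct_zero]) <;>
    ring

theorem weight_posSemidef {k t : ℝ} (hk : 0 ≤ k) (ht : 0 ≤ t) : (weight d k t).PosSemidef := by
  refine Matrix.PosSemidef.diagonal ?_
  rintro (_ | _) <;> simpa

theorem connLaplacian_posSemidef (hκ : ∀ e ∈ E, 0 < κ e.1 e.2) (hτ : ∀ e ∈ E, 0 < τ e.1 e.2) :
    (connLaplacian E κ τ meas).PosSemidef := by
  rw [connLaplacian_eq_sum]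
  refine Matrix.posSemidef_sum _ fun e he => ?_
  have := (weight_posSemidef (d := d) (hκ e he).le (hτ e he).le).conjTranspose_mul_mul_same
    (edgeDiff (meas e.1 e.2) e.1 e.2)
  simpa using this

theorem dotProduct_connLaplacian (x : Idx n d → ℝ) :
    x ⬝ᵥ connLaplacian E κ τ meas *ᵥ x = ∑ e ∈ E,
      (κ e.1 e.2 * ∑ b, ((edgeDiff (meas e.1 e.2) e.1 e.2 *ᵥ x) (Sum.inl b)) ^ 2 +
        τ e.1 e.2 * ((edgeDiff (meas e.1 e.2) e.1 e.2 *ᵥ x) (Sum.inr ())) ^ 2) := by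
  rw [connLaplacian_eq_sum, Matrix.sum_mulVec, dotProduct_sum]
  refine Finset.sum_congr rfl fun e _ => ?_
  rw [← Matrix.mulVec_mulVec, ← Matrix.mulVec_mulVec, Matrix.dotProduct_mulVec,
    Matrix.vecMul_transpose]
  simp only [weight, Matrix.mulVec_diagonal, dotProduct, Fintype.sum_sum_type, Sum.elim_inl,
    Sum.elim_inr, Finset.univ_unique, Finset.sum_singleton, Finset.mul_sum]
  congr 1
  · exact Finset.sum_congr rfl fun b _ => by ring
  · simp; ring

theorem trace_mul_mul_transpose {m ι : Type*} [Fintype m] [Fintype ι]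
    (X : Matrix m ι ℝ) (Q : Matrix ι ι ℝ) :
    (X * Q * Xᵀ).trace = ∑ a, X a ⬝ᵥ Q *ᵥ X a := by
  simp only [Matrix.trace, Matrix.diag]
  refine Finset.sum_congr rfl fun a _ => ?_
  rw [Matrix.dotProduct_mulVec]
  simp [Matrix.mul_apply, dotProduct, Matrix.vecMul]

theorem cost_eq_trace (T : Fin n → Pose d) :
    cost E κ τ meas T = (blockRow T * connLaplacian E κ τ meas * (blockRow T)ᵀ).trace := by
  rw [trace_mul_mul_transpose]
  simp only [dotProduct_connLaplacian]
  rw [Finset.sum_comm]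
  refine Finset.sum_congr rfl fun e _ => ?_
  rw [Finset.sum_add_distrib, ← Finset.mul_sum, ← Finset.mul_sum]
  simp only [edgeDiff_mulVec_inl, edgeDiff_mulVec_inr]
  simp only [frobSq, normSq, blockRow, Matrix.of_apply,
    Sum.elim_inl, Sum.elim_inr, Matrix.sub_apply, Matrix.mul_apply, Pi.sub_apply, Matrix.mulVec,
    dotProduct]
  simp only [mul_comm]

theorem sdpObj_transpose_mul {m : Type*} [Fintype m] (Q : Matrix (Idx n d) (Idx n d) ℝ)
    (hQ : Qᵀ = Q) (X : Matrix m (Idx n d) ℝ) : sdpObj Q (Xᵀ * X) = (X * Q * Xᵀ).trace := by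
  rw [sdpObj, hQ, Matrix.mul_assoc X, Matrix.trace_mul_comm X, Matrix.mul_assoc]

theorem _root_.Pose.R_transpose_mul (P : Pose d) : P.Rᵀ * P.R = 1 := by
  have := (Matrix.mem_specialOrthogonalGroup_iff.1 P.rot.2).1
  exact (Matrix.mem_orthogonalGroup_iff' _ _).1 this

theorem _root_.Pose.R_mul_transpose (P : Pose d) : P.R * P.Rᵀ = 1 :=
  mul_eq_one_comm.1 (Pose.R_transpose_mul P)

theorem cost_rel_eq_zero (truth : Fin n → Pose d) :
    cost E κ τ (fun i j => (truth i).rel (truth j)) truth = 0 := by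
  refine Finset.sum_eq_zero fun e _ => ?_
  have h1 : (truth e.1).R * ((truth e.1).rel (truth e.2)).R = (truth e.2).R := by
    have : ((truth e.1).rel (truth e.2)).R = (truth e.1).Rᵀ * (truth e.2).R := rfl
    rw [this, ← Matrix.mul_assoc, Pose.R_mul_transpose, Matrix.one_mul]
  have h2 : (truth e.1).R *ᵥ ((truth e.1).rel (truth e.2)).trans =
      (truth e.2).trans - (truth e.1).trans := by
    simp only [Pose.rel, Matrix.mulVec_mulVec, Pose.R_mul_transpose, Matrix.one_mulVec]
  simp [h1, h2, frobSq, normSq]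

/-- A zero form makes every edge residual vanish. Vanishing at one endpoint then passes to the
other, forward directly and backward because the measured rotation is invertible, so it spreads from
pose `0` along walks. -/
theorem eq_zero_of_dotProduct_connLaplacian [NeZero n] (hE : WeaklyConnected E)
    (hκ : ∀ e ∈ E, 0 < κ e.1 e.2) (hτ : ∀ e ∈ E, 0 < τ e.1 e.2) (x : Idx n d → ℝ)
    (hx : x ⬝ᵥ connLaplacian E κ τ meas *ᵥ x = 0) (h0 : ∀ c, x (0, c) = 0) : x = 0 := by
  rw [dotProduct_connLaplacian, Finset.sum_eq_zero_iff_of_nonneg] at hx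
  swap
  · intro e he
    have := hκ e he; have := hτ e he
    positivity
  have hedge : ∀ e ∈ E, ∀ c, (edgeDiff (meas e.1 e.2) e.1 e.2 *ᵥ x) c = 0 := by
    intro e he
    have h := hx e he
    have h1 := hκ e he
    have h2 := hτ e he
    rw [add_eq_zero_iff_of_nonneg (by positivity) (by positivity)] at h
    rintro (b | u)
    · have h3 := (mul_eq_zero.1 h.1).resolve_left h1.ne'
      rw [Finset.sum_eq_zero_iff_of_nonneg (fun _ _ => by positivity)] at h3
      exact pow_eq_zero_iff (two_ne_zero) |>.1 (h3 b (Finset.mem_univ _))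
    · exact pow_eq_zero_iff (two_ne_zero) |>.1 ((mul_eq_zero.1 h.2).resolve_left h2.ne')
  have step1 : ∀ e ∈ E, (∀ c, x (e.1, c) = 0) → ∀ c, x (e.2, c) = 0 := by
    intro e he h c
    have := hedge e he c
    rw [edgeDiff_mulVec] at this
    simpa [h] using this
  have step2 : ∀ e ∈ E, (∀ c, x (e.2, c) = 0) → ∀ c, x (e.1, c) = 0 := by
    intro e he h
    have hr : (meas e.1 e.2).Rᵀ *ᵥ (fun b => x (e.1, Sum.inl b)) = 0 := by
      ext b
      have := hedge e he (Sum.inl b)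
      rw [edgeDiff_mulVec_inl, h, zero_sub, neg_eq_zero] at this
      simpa [Matrix.mulVec, dotProduct] using this
    have hr' : (fun b => x (e.1, Sum.inl b)) = 0 := by
      have := congrArg ((meas e.1 e.2).R *ᵥ ·) hr
      simpa [Matrix.mulVec_mulVec, Pose.R_mul_transpose] using this
    have hl : ∀ b, x (e.1, Sum.inl b) = 0 := fun b => congrFun hr' b
    rintro (b | u)
    · exact hl b
    · have := hedge e he (Sum.inr ())
      rw [edgeDiff_mulVec_inr, h] at this
      simpa [hl] using this
  have hall : ∀ i : Fin n, ∀ c, x (i, c) = 0 := by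
    intro i
    obtain ⟨w⟩ := hE.preconnected 0 i
    have key : ∀ u v : Fin n, (SimpleGraph.fromRel fun i j : Fin n => (i, j) ∈ E).Walk u v →
        (∀ c, x (u, c) = 0) → ∀ c, x (v, c) = 0 := by
      intro u v w
      induction w with
      | nil => exact id
      | cons h _ ih =>
        intro hu
        refine ih ?_
        rw [SimpleGraph.fromRel_adj] at h
        rcases h.2 with h | h
        · exact step1 _ h hu
        · exact step2 _ h hu
    exact key 0 i w h0
  ext ⟨i, c⟩
  exact hall i c

/-- The translation-invariance direction: `1` in every translation coordinate. -/
def transOnes (n d : ℕ) : Idx n d → ℝ := fun p => Sum.elim (fun _ => 0) (fun _ => 1) p.2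

theorem connLaplacian_mulVec_transOnes :
    connLaplacian E κ τ meas *ᵥ transOnes n d = 0 := by
  rw [connLaplacian_eq_sum, Matrix.sum_mulVec]
  refine Finset.sum_eq_zero fun e _ => ?_
  have : edgeDiff (meas e.1 e.2) e.1 e.2 *ᵥ transOnes n d = 0 := by
    ext (b | u)
    · rw [edgeDiff_mulVec_inl]; simp [transOnes]
    · rw [edgeDiff_mulVec_inr]; simp [transOnes]
  rw [← Matrix.mulVec_mulVec, this, Matrix.mulVec_zero]

end PGO

/-! ### Compactness of `SO(d)`, curves in it, and minimization over a compact set plus a subspace.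
-/

theorem Matrix.isCompact_specialOrthogonalGroup (d : ℕ) :
    IsCompact (Matrix.specialOrthogonalGroup (Fin d) ℝ : Set (Matrix (Fin d) (Fin d) ℝ)) := by
  have hc : IsCompact (Set.univ.pi fun _ : Fin d => Set.univ.pi fun _ : Fin d =>
      Set.Icc (-1 : ℝ) 1) :=
    isCompact_univ_pi fun _ => isCompact_univ_pi fun _ => isCompact_Icc
  refine hc.of_isClosed_subset ?_ ?_
  · have : (Matrix.specialOrthogonalGroup (Fin d) ℝ : Set (Matrix (Fin d) (Fin d) ℝ)) =
        {A | A * Aᵀ = 1} ∩ {A | A.det = 1} := by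
      ext A
      simp only [SetLike.mem_coe, Matrix.mem_specialOrthogonalGroup_iff, Set.mem_inter_iff,
        Set.mem_ofPred_eq]
      rw [Matrix.mem_orthogonalGroup_iff]
    rw [this]
    exact (isClosed_eq (by fun_prop) continuous_const).inter
      (isClosed_eq (by fun_prop) continuous_const)
  · intro A hA i _ j _
    have := entry_norm_bound_of_unitary (𝕜 := ℝ)
      (Matrix.mem_specialOrthogonalGroup_iff.1 hA).1 i j
    exact abs_le.1 this

theorem Matrix.exp_mem_specialOrthogonalGroup {d : ℕ} {A : Matrix (Fin d) (Fin d) ℝ}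
    (hA : Aᵀ = -A) : NormedSpace.exp A ∈ Matrix.specialOrthogonalGroup (Fin d) ℝ := by
  have horth : ∀ B : Matrix (Fin d) (Fin d) ℝ, Bᵀ = -B →
      NormedSpace.exp B * (NormedSpace.exp B)ᵀ = 1 := by
    intro B hB
    rw [← Matrix.exp_transpose, hB, ← Matrix.exp_add_of_commute _ _ (Commute.refl B).neg_right,
      add_neg_cancel, NormedSpace.exp_zero]
  rw [Matrix.mem_specialOrthogonalGroup_iff]
  refine ⟨(Matrix.mem_orthogonalGroup_iff _ _).2 (horth A hA), ?_⟩
  -- Halving excludes determinant `-1`: `det (exp A) = (det (exp B))²`, which is `1` by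
  -- orthogonality of `exp B`.
  set B := (1 / 2 : ℝ) • A with hB
  have hBt : Bᵀ = -B := by rw [hB, Matrix.transpose_smul, hA, smul_neg]
  have h1 : NormedSpace.exp A = NormedSpace.exp B * NormedSpace.exp B := by
    rw [← Matrix.exp_add_of_commute _ _ (Commute.refl B), hB, ← add_smul]
    norm_num
  have h2 := congrArg Matrix.det (horth B hBt)
  rw [Matrix.det_mul, Matrix.det_transpose, Matrix.det_one] at h2
  rw [h1, Matrix.det_mul, h2]

open scoped Matrix.Norms.Operator in
theorem Matrix.hasDerivAt_mul_exp_smul_apply {d : ℕ} (B A : Matrix (Fin d) (Fin d) ℝ)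
    (a b : Fin d) :
    HasDerivAt (fun s : ℝ => (B * NormedSpace.exp (s • A)) a b) ((B * A) a b) 0 := by
  have h := hasDerivAt_exp_smul_const (𝕂 := ℝ) A 0
  rw [zero_smul, NormedSpace.exp_zero, one_mul] at h
  let l : Matrix (Fin d) (Fin d) ℝ →ₗ[ℝ] ℝ :=
    Matrix.entryLinearMap ℝ ℝ a b ∘ₗ LinearMap.mulLeft ℝ B
  exact (LinearMap.toContinuousLinearMap l).hasFDerivAt.comp_hasDerivAt (0 : ℝ) h

/-- Minimizing over `v` first gives the distance from `f k` to the closed subspace `range g`. This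
is attained and continuous in `k`, so no bound on `v` is needed. -/
theorem exists_norm_add_le_of_isCompact {K V W : Type*} [TopologicalSpace K] [CompactSpace K]
    [Nonempty K] [AddCommGroup V] [Module ℝ V] [NormedAddCommGroup W] [NormedSpace ℝ W]
    [FiniteDimensional ℝ W] (f : K → W) (hf : Continuous f) (g : V →ₗ[ℝ] W) :
    ∃ k v, ∀ k' v', ‖f k + g v‖ ≤ ‖f k' + g v'‖ := by
  let S : Set W := LinearMap.range g
  have hS : IsClosed S := (LinearMap.range g).closed_of_finiteDimensional
  have hne : S.Nonempty := ⟨0, (LinearMap.range g).zero_mem⟩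
  have : ProperSpace W := FiniteDimensional.proper_real W
  obtain ⟨k, -, hk⟩ := isCompact_univ.exists_isMinOn Set.univ_nonempty
    ((Metric.continuous_infDist_pt S).comp hf).continuousOn
  obtain ⟨y, ⟨v, rfl⟩, hy⟩ := hS.exists_infDist_eq_dist hne (f k)
  refine ⟨k, -v, fun k' v' => ?_⟩
  have h1 : ‖f k + g (-v)‖ = Metric.infDist (f k) S := by
    rw [hy, dist_eq_norm, map_neg, sub_eq_add_neg]
  have h2 : Metric.infDist (f k') S ≤ ‖f k' + g v'‖ := by
    have := Metric.infDist_le_dist_of_mem (x := f k') (show g (-v') ∈ S from ⟨-v', rfl⟩)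
    rwa [dist_eq_norm, map_neg, sub_neg_eq_add] at this
  exact h1.trans_le ((hk (Set.mem_univ k')).trans h2)

theorem exists_sum_sq_add_le_of_isCompact {K V ι : Type*} [TopologicalSpace K] [CompactSpace K]
    [Nonempty K] [AddCommGroup V] [Module ℝ V] [Fintype ι]
    (f : K → ι → ℝ) (hf : Continuous f) (g : V →ₗ[ℝ] ι → ℝ) :
    ∃ k v, ∀ k' v', ∑ i, (f k i + g v i) ^ 2 ≤ ∑ i, (f k' i + g v' i) ^ 2 := by
  obtain ⟨k, v, h⟩ := exists_norm_add_le_of_isCompact (W := EuclideanSpace ℝ ι)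
    (fun k => WithLp.toLp 2 (f k)) ((PiLp.continuous_toLp 2 _).comp hf)
    ((WithLp.linearEquiv 2 ℝ (ι → ℝ)).symm.toLinearMap ∘ₗ g)
  refine ⟨k, v, fun k' v' => ?_⟩
  have := pow_le_pow_left₀ (norm_nonneg _) (h k' v') 2
  simpa [EuclideanSpace.norm_sq_eq] using this

open scoped MatrixOrder Matrix.Norms.L2Operator in
theorem Matrix.PosSemidef.exists_eq_transpose_mul_self {ι : Type*} [Fintype ι] [DecidableEq ι]
    {A : Matrix ι ι ℝ} (hA : A.PosSemidef) : ∃ B : Matrix ι ι ℝ, A = Bᵀ * B := by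
  obtain ⟨B, hB⟩ := CStarAlgebra.nonneg_iff_eq_star_mul_self.mp hA.nonneg
  exact ⟨B, by rw [hB, Matrix.star_eq_conjTranspose, Matrix.conjTranspose_eq_transpose_of_trivial]⟩

/-! ### Existence of a PGO optimum and its first-order conditions. -/

namespace PGO

variable {n d : ℕ}
variable (E : Finset (Fin n × Fin n)) (κ τ : Fin n → Fin n → ℝ) (meas : Fin n → Fin n → Pose d)

/-- The rotation columns of `[R₁ t₁ ⋯ Rₙ tₙ]`, the translation columns being zero. -/
def rotColumns (r : Fin n → Matrix.specialOrthogonalGroup (Fin d) ℝ) :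
    Matrix (Fin d) (Idx n d) ℝ :=
  Matrix.of fun a p => Sum.elim (fun b => (r p.1).1 a b) (fun _ => 0) p.2

/-- The translation columns of `[R₁ t₁ ⋯ Rₙ tₙ]`, the rotation columns being zero. -/
def transColumns : (Fin n → Fin d → ℝ) →ₗ[ℝ] Matrix (Fin d) (Idx n d) ℝ where
  toFun t := Matrix.of fun a p => Sum.elim (fun _ => 0) (fun _ => t p.1 a) p.2
  map_add' s t := by ext a ⟨i, b | u⟩ <;> simp
  map_smul' c t := by ext a ⟨i, b | u⟩ <;> simp

theorem continuous_rotColumns :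
    Continuous (rotColumns : (Fin n → Matrix.specialOrthogonalGroup (Fin d) ℝ) → _) := by
  refine continuous_matrix fun a p => ?_
  rcases p with ⟨i, b | u⟩
  · exact (continuous_subtype_val.comp (continuous_apply i)).matrix_elem a b
  · exact continuous_const

theorem blockRow_eq_add (T : Fin n → Pose d) :
    blockRow T = rotColumns (fun i => (T i).rot) + transColumns (fun i => (T i).trans) := by
  ext a ⟨i, b | u⟩ <;> simp [rotColumns, transColumns, blockRow, Pose.R]

theorem trace_mul_transpose_mul_self {m ι : Type*} [Fintype m] [Fintype ι]
    (X : Matrix m ι ℝ) (B : Matrix ι ι ℝ) :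
    (X * (Bᵀ * B) * Xᵀ).trace = ∑ q : m × ι, ((X * Bᵀ) q.1 q.2) ^ 2 := by
  have : X * (Bᵀ * B) * Xᵀ = X * Bᵀ * (X * Bᵀ)ᵀ := by
    rw [Matrix.transpose_mul, Matrix.transpose_transpose]
    simp only [Matrix.mul_assoc]
  rw [this, Fintype.sum_prod_type]
  simp only [Matrix.trace, Matrix.diag, Matrix.mul_apply (N := (X * Bᵀ)ᵀ), Matrix.transpose_apply, sq]

/-- With `Q = Bᵀ B` the cost is the squared norm of `X Bᵀ`: a continuous function of the rotations,
which range over a compact set, plus a linear function of the unbounded translations. -/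
theorem exists_isOptimal (hκ : ∀ e ∈ E, 0 < κ e.1 e.2) (hτ : ∀ e ∈ E, 0 < τ e.1 e.2) :
    ∃ T : Fin n → Pose d, IsOptimal E κ τ meas T := by
  obtain ⟨B, hB⟩ :=
    (connLaplacian_posSemidef E κ τ meas hκ hτ).exists_eq_transpose_mul_self
  have : CompactSpace (Matrix.specialOrthogonalGroup (Fin d) ℝ) :=
    isCompact_iff_compactSpace.1 (Matrix.isCompact_specialOrthogonalGroup d)
  obtain ⟨r, t, h⟩ := exists_sum_sq_add_le_of_isCompact
    (fun (r : Fin n → Matrix.specialOrthogonalGroup (Fin d) ℝ) (q : Fin d × Idx n d) =>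
      (rotColumns r * Bᵀ) q.1 q.2)
    (continuous_pi fun q =>
      (continuous_rotColumns.matrix_mul continuous_const).matrix_elem q.1 q.2)
    (LinearMap.pi fun q => Matrix.entryLinearMap ℝ ℝ q.1 q.2 ∘ₗ
      mulRightLinearMap (Fin d) ℝ Bᵀ ∘ₗ transColumns)
  have hcost : ∀ T : Fin n → Pose d, cost E κ τ meas T =
      ∑ q : Fin d × Idx n d, ((rotColumns (fun i => (T i).rot) * Bᵀ) q.1 q.2 +
        (transColumns (fun i => (T i).trans) * Bᵀ) q.1 q.2) ^ 2 := by
    intro T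
    rw [cost_eq_trace, hB, trace_mul_transpose_mul_self, blockRow_eq_add]
    simp only [Matrix.add_mul, Matrix.add_apply]
  refine ⟨fun i => ⟨r i, t i⟩, fun T' => ?_⟩
  rw [hcost, hcost]
  exact h (fun i => (T' i).rot) fun i => (T' i).trans

/-- First-order optimality of a quadratic form along a curve of matrices. -/
theorem sum_deriv_mul_eq_zero {m ι : Type*} [Fintype m] [Fintype ι] (Q : Matrix ι ι ℝ)
    (hQ : Qᵀ = Q) (γ : ℝ → Matrix m ι ℝ) (Y : Matrix m ι ℝ)
    (hγ : ∀ a p, HasDerivAt (fun s => γ s a p) (Y a p) 0)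
    (hmin : ∀ s, (γ 0 * Q * (γ 0)ᵀ).trace ≤ (γ s * Q * (γ s)ᵀ).trace) :
    ∑ a, ∑ p, Y a p * (γ 0 * Q) a p = 0 := by
  have hφ : ∀ s, (γ s * Q * (γ s)ᵀ).trace = ∑ a, ∑ p, γ s a p * ∑ q, Q p q * γ s a q := by
    intro s; rw [trace_mul_mul_transpose]; rfl
  have hd : HasDerivAt (fun s => (γ s * Q * (γ s)ᵀ).trace)
      (∑ a, ∑ p, (Y a p * (∑ q, Q p q * γ 0 a q) + γ 0 a p * ∑ q, Q p q * Y a q)) 0 := by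
    simp only [hφ]
    refine HasDerivAt.fun_sum fun a _ => HasDerivAt.fun_sum fun p _ => (hγ a p).mul ?_
    exact HasDerivAt.fun_sum fun q _ => (hγ a q).const_mul _
  have h0 := IsLocalMin.hasDerivAt_eq_zero (Filter.Eventually.of_forall hmin) hd
  have hG : ∀ a p, (γ 0 * Q) a p = ∑ q, Q p q * γ 0 a q := by
    intro a p
    rw [Matrix.mul_apply]
    refine Finset.sum_congr rfl fun q _ => ?_
    rw [← Matrix.transpose_apply Q, hQ, mul_comm]
  have hsym : ∀ a, ∑ p, γ 0 a p * ∑ q, Q p q * Y a q = ∑ p, Y a p * (γ 0 * Q) a p := by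
    intro a
    simp only [Finset.mul_sum, Matrix.mul_apply]
    rw [Finset.sum_comm]
    exact Finset.sum_congr rfl fun p _ => Finset.sum_congr rfl fun q _ => by ring
  simp only [Finset.sum_add_distrib, hsym, ← hG] at h0
  linarith

/-- Only pose `i` is varied, along `Rᵢ exp(sA)` and `tᵢ + s u`, and the cost has a minimum at `s =
0`. -/
theorem IsOptimal.sum_eq_zero {E : Finset (Fin n × Fin n)} {κ τ : Fin n → Fin n → ℝ}
    {meas : Fin n → Fin n → Pose d} {T : Fin n → Pose d} (hT : IsOptimal E κ τ meas T)
    (hQ : (connLaplacian E κ τ meas)ᵀ = connLaplacian E κ τ meas)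
    (i : Fin n) (A : Matrix (Fin d) (Fin d) ℝ) (hA : Aᵀ = -A) (u : Fin d → ℝ) :
    ∑ a, (∑ b, ((T i).R * A) a b * (blockRow T * connLaplacian E κ τ meas) a (i, Sum.inl b) +
      u a * (blockRow T * connLaplacian E κ τ meas) a (i, Sum.inr ())) = 0 := by
  have hA' : ∀ s : ℝ, (s • A)ᵀ = -(s • A) := fun s => by
    rw [Matrix.transpose_smul, hA, smul_neg]
  let T' : ℝ → Fin n → Pose d := fun s => Function.update T i
    ⟨(T i).rot * ⟨_, Matrix.exp_mem_specialOrthogonalGroup (hA' s)⟩, (T i).trans + s • u⟩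
  have hT'0 : blockRow (T' 0) = blockRow T := by
    ext a ⟨j, b | c⟩
    · by_cases hj : j = i
      · subst hj; simp [blockRow, T', Pose.R]
      · simp [blockRow, T', hj]
    · by_cases hj : j = i
      · subst hj; simp [blockRow, T']
      · simp [blockRow, T', hj]
  let Y : Matrix (Fin d) (Idx n d) ℝ := Matrix.of fun a p =>
    if p.1 = i then Sum.elim (fun b => ((T i).R * A) a b) (fun _ => u a) p.2 else 0
  have key := sum_deriv_mul_eq_zero (connLaplacian E κ τ meas) hQ (fun s => blockRow (T' s)) Y
    (by
      rintro a ⟨j, b | c⟩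
      · by_cases hj : j = i
        · subst hj
          have := Matrix.hasDerivAt_mul_exp_smul_apply (T j).R A a b
          simpa [blockRow, T', Pose.R, Y] using this
        · simpa [blockRow, T', hj, Y] using hasDerivAt_const (0 : ℝ) ((T j).R a b)
      · by_cases hj : j = i
        · subst hj
          have := ((hasDerivAt_id (0 : ℝ)).mul_const (u a)).const_add ((T j).trans a)
          simpa [blockRow, T', Y] using this
        · simpa [blockRow, T', hj, Y] using hasDerivAt_const (0 : ℝ) ((T j).trans a))
    (by
      intro s
      simp only [hT'0]
      rw [← cost_eq_trace, ← cost_eq_trace]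
      exact hT _)
  simp only [hT'0] at key
  rw [← key]
  refine Finset.sum_congr rfl fun a _ => ?_
  rw [Fintype.sum_prod_type, Finset.sum_eq_single i]
  · simp [Y]
  · intro j _ hj; simp [Y, hj]
  · simp

end PGO

/-! ### Bounds for quadratic forms. -/

theorem Matrix.dotProduct_mulVec_sub {ι : Type*} [Fintype ι] {S : Matrix ι ι ℝ} (hS : Sᵀ = S)
    (x k : ι → ℝ) (hk : S *ᵥ k = 0) : (x - k) ⬝ᵥ S *ᵥ (x - k) = x ⬝ᵥ S *ᵥ x := by
  have : k ⬝ᵥ S *ᵥ x = 0 := by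
    rw [Matrix.dotProduct_mulVec, ← Matrix.mulVec_transpose, hS, hk, zero_dotProduct]
  rw [Matrix.mulVec_sub, hk, sub_zero, sub_dotProduct, this, sub_zero]

/-- Cauchy–Schwarz between `A` and `x xᵀ`; it lets the Frobenius norm control the multiplier. -/
theorem Matrix.sq_dotProduct_mulVec_le {ι : Type*} [Fintype ι] (A : Matrix ι ι ℝ) (x : ι → ℝ) :
    (x ⬝ᵥ A *ᵥ x) ^ 2 ≤ (∑ p, ∑ q, A p q ^ 2) * (x ⬝ᵥ x) ^ 2 := by
  have h1 : x ⬝ᵥ A *ᵥ x = ∑ r : ι × ι, A r.1 r.2 * (x r.1 * x r.2) := by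
    simp only [dotProduct, Matrix.mulVec, Finset.mul_sum, Fintype.sum_prod_type]
    exact Finset.sum_congr rfl fun p _ => Finset.sum_congr rfl fun q _ => by ring
  have h2 : (x ⬝ᵥ x) ^ 2 = ∑ r : ι × ι, (x r.1 * x r.2) ^ 2 := by
    simp only [dotProduct, sq, Finset.sum_mul_sum, Fintype.sum_prod_type]
    exact Finset.sum_congr rfl fun p _ => Finset.sum_congr rfl fun q _ => by ring
  rw [h1, h2, ← Fintype.sum_prod_type (f := fun r : ι × ι => A r.1 r.2 ^ 2)]
  exact Finset.sum_mul_sq_le_sq_mul_sq _ _ _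

/-- For `Q ⪰ 0` with `Q ⪯ M`, `‖Q x‖² ≤ M xᵀ Q x`. -/
theorem Matrix.PosSemidef.dotProduct_mulVec_self_le {ι : Type*} [Fintype ι] {Q : Matrix ι ι ℝ}
    (hQ : Q.PosSemidef) {M : ℝ} (hM : 0 < M) (hQM : ∀ y, y ⬝ᵥ Q *ᵥ y ≤ M * (y ⬝ᵥ y))
    (x : ι → ℝ) : (Q *ᵥ x) ⬝ᵥ (Q *ᵥ x) ≤ M * (x ⬝ᵥ Q *ᵥ x) := by
  have hT : Qᵀ = Q := by simpa using hQ.isHermitian.eq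
  set y := Q *ᵥ x with hy
  -- Expanding at `M x - Q x` gives `2 M ‖y‖² ≤ M² xᵀ Q x + yᵀ Q y`, and the last term is at most `M
  -- ‖y‖²`.
  have h1 := hQ.dotProduct_mulVec_nonneg (M • x - y)
  have h2 : x ⬝ᵥ Q *ᵥ y = y ⬝ᵥ y := by
    rw [Matrix.dotProduct_mulVec, ← Matrix.mulVec_transpose, hT]
  simp only [star_trivial, Matrix.mulVec_sub, Matrix.mulVec_smul, sub_dotProduct, dotProduct_sub,
    smul_dotProduct, dotProduct_smul, smul_eq_mul, h2, ← hy] at h1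
  have h3 := hQM y
  have h4 : M * (y ⬝ᵥ y) ≤ M * (M * (x ⬝ᵥ y)) := by linarith
  exact le_of_mul_le_mul_left h4 hM

/-! ### Coercivity off pose `0`, and the Lagrange multipliers. -/

namespace PGO

variable {n d : ℕ}

theorem abs_dotProduct_mulVec_le_specNorm (A : Matrix (Idx n d) (Idx n d) ℝ) (x : Idx n d → ℝ) :
    |x ⬝ᵥ A *ᵥ x| ≤ specNorm A * (x ⬝ᵥ x) := by
  set X : EuclideanSpace ℝ (Idx n d) := WithLp.toLp 2 x
  have h1 := Matrix.inner_toEuclideanCLM A X X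
  have h2 : x ⬝ᵥ x = ‖X‖ * ‖X‖ := by
    rw [← sq, EuclideanSpace.norm_sq_eq]
    exact Finset.sum_congr rfl fun i _ => by rw [Real.norm_eq_abs, sq_abs, sq]
  have h3 : x ⬝ᵥ A *ᵥ x = inner ℝ X (Matrix.toEuclideanCLM (𝕜 := ℝ) A X) := h1.symm
  rw [h3, h2]
  calc _ ≤ ‖X‖ * ‖Matrix.toEuclideanCLM (𝕜 := ℝ) A X‖ := abs_real_inner_le_norm _ _
    _ ≤ ‖X‖ * (specNorm A * ‖X‖) := by
        gcongr; exact ContinuousLinearMap.le_opNorm _ _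
    _ = _ := by ring

theorem specNorm_nonneg (A : Matrix (Idx n d) (Idx n d) ℝ) : 0 ≤ specNorm A := norm_nonneg _

/-- The form attains its minimum on the unit sphere of the subspace of vectors vanishing at pose
`0`; that minimum is positive since the form has no nonzero null vector there. -/
theorem exists_pos_mul_le_dotProduct_connLaplacian [NeZero n] (E : Finset (Fin n × Fin n))
    (κ τ : Fin n → Fin n → ℝ) (meas : Fin n → Fin n → Pose d) (hE : WeaklyConnected E)
    (hκ : ∀ e ∈ E, 0 < κ e.1 e.2) (hτ : ∀ e ∈ E, 0 < τ e.1 e.2) :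
    ∃ c : ℝ, 0 < c ∧ ∀ v : Idx n d → ℝ, (∀ s, v (0, s) = 0) →
      c * (v ⬝ᵥ v) ≤ v ⬝ᵥ connLaplacian E κ τ meas *ᵥ v := by
  set Q := connLaplacian E κ τ meas
  have hQ : Q.PosSemidef := connLaplacian_posSemidef E κ τ meas hκ hτ
  let K : Set (Idx n d → ℝ) := {v | v ⬝ᵥ v = 1} ∩ ⋂ s, {v | v (0, s) = 0}
  have hK : IsCompact K := by
    have hc : IsCompact (Set.univ.pi fun _ : Idx n d => Set.Icc (-1 : ℝ) 1) :=
      isCompact_univ_pi fun _ => isCompact_Icc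
    refine hc.of_isClosed_subset ?_ ?_
    · refine (isClosed_eq ?_ continuous_const).inter
        (isClosed_iInter fun s => isClosed_eq (continuous_apply _) continuous_const)
      exact continuous_id.dotProduct continuous_id
    · rintro v ⟨hv, -⟩ p -
      have h1 : v p * v p ≤ v ⬝ᵥ v :=
        Finset.single_le_sum (f := fun p => v p * v p) (fun q _ => mul_self_nonneg _)
          (Finset.mem_univ p)
      rw [show v ⬝ᵥ v = 1 from hv] at h1
      exact abs_le.1 ((sq_le_one_iff_abs_le_one _).1 (by rwa [sq]))
  have hcont : Continuous fun v : Idx n d → ℝ => v ⬝ᵥ Q *ᵥ v :=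
    continuous_id.dotProduct (continuous_const.matrix_mulVec continuous_id)
  have hscale : ∀ v : Idx n d → ℝ, v ≠ 0 → (∀ s, v (0, s) = 0) →
      0 < v ⬝ᵥ v ∧ (√(v ⬝ᵥ v))⁻¹ • v ∈ K := by
    intro v hv hv0
    have hnn : 0 ≤ v ⬝ᵥ v := Finset.sum_nonneg fun _ _ => mul_self_nonneg _
    have hpos : 0 < v ⬝ᵥ v := hnn.lt_of_ne' fun h => hv (dotProduct_self_eq_zero.1 h)
    refine ⟨hpos, ?_, ?_⟩
    · have hs := Real.mul_self_sqrt hnn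
      have hs0 : √(v ⬝ᵥ v) ≠ 0 := (Real.sqrt_pos.2 hpos).ne'
      change _ ⬝ᵥ _ = _
      rw [smul_dotProduct, dotProduct_smul, smul_eq_mul, smul_eq_mul]
      field_simp
      rw [sq, hs]
    · simp [hv0]
  by_cases hne : K.Nonempty
  · obtain ⟨u, hu, hmin⟩ := hK.exists_isMinOn hne hcont.continuousOn
    have hu0 : ∀ s, u (0, s) = 0 := by simpa using hu.2
    refine ⟨u ⬝ᵥ Q *ᵥ u, ?_, ?_⟩
    · have h0 : 0 ≤ u ⬝ᵥ Q *ᵥ u := by simpa using hQ.dotProduct_mulVec_nonneg u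
      refine h0.lt_of_ne' fun h => ?_
      have : u = 0 := eq_zero_of_dotProduct_connLaplacian E κ τ meas hE hκ hτ u h hu0
      have h1 : u ⬝ᵥ u = 1 := hu.1
      simp [this] at h1
    · intro v hv0
      by_cases hv : v = 0
      · simp [hv]
      obtain ⟨hpos, hmem⟩ := hscale v hv hv0
      have h1 := hmin hmem
      simp only [Set.mem_ofPred_eq, Matrix.mulVec_smul, smul_dotProduct, dotProduct_smul,
        smul_eq_mul] at h1
      have hs := Real.mul_self_sqrt hpos.le
      rw [← mul_assoc, ← mul_inv, hs, inv_mul_eq_div, le_div_iff₀ hpos] at h1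
      exact h1
  -- An empty sphere means the subspace is zero, so any constant works.
  · refine ⟨1, one_pos, fun v hv0 => ?_⟩
    by_cases hv : v = 0
    · simp [hv]
    · exact absurd ⟨_, (hscale v hv hv0).2⟩ hne

/-- The symmetric Lagrange multiplier of `Rᵢᵀ Rᵢ = I` at the poses `T`, with `G = [R₁ t₁ ⋯] Q`. -/
def multiplierBlock (T : Fin n → Pose d) (G : Matrix (Fin d) (Idx n d) ℝ) (i : Fin n) :
    Matrix (Fin d) (Fin d) ℝ :=
  (T i).Rᵀ * G.submatrix id fun b => (i, Sum.inl b)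

/-- The block-diagonal matrix of Lagrange multipliers. -/
def multiplier (T : Fin n → Pose d) (G : Matrix (Fin d) (Idx n d) ℝ) :
    Matrix (Idx n d) (Idx n d) ℝ :=
  Matrix.of fun p q =>
    if p.1 = q.1 then Matrix.fromBlocks (multiplierBlock T G p.1) 0 0 0 p.2 q.2 else 0

variable (T : Fin n → Pose d) (G : Matrix (Fin d) (Idx n d) ℝ)

theorem blockRow_mul_multiplier (hG : ∀ a i, G a (i, Sum.inr ()) = 0) :
    blockRow T * multiplier T G = G := by
  ext a ⟨j, q⟩
  rw [Matrix.mul_apply, Fintype.sum_prod_type, Finset.sum_eq_single j]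
  · rcases q with b | u
    · have h : (T j).R * multiplierBlock T G j = G.submatrix id fun b => (j, Sum.inl b) := by
        rw [multiplierBlock, ← Matrix.mul_assoc, Pose.R_mul_transpose, Matrix.one_mul]
      have := congrFun (congrFun h a) b
      simpa [Matrix.mul_apply, blockRow, multiplier] using this
    · simp [blockRow, multiplier, hG]
  · intro i _ hi; simp [multiplier, hi]
  · simp

theorem multiplier_mulVec_transOnes : multiplier T G *ᵥ transOnes n d = 0 := by
  ext ⟨j, q⟩
  rw [Matrix.mulVec, dotProduct, Fintype.sum_prod_type]
  refine Finset.sum_eq_zero fun i _ => ?_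
  rcases q with b | u <;> by_cases h : j = i <;> simp [multiplier, transOnes, h]

theorem multiplier_transpose (h : ∀ i, (multiplierBlock T G i)ᵀ = multiplierBlock T G i) :
    (multiplier T G)ᵀ = multiplier T G := by
  ext ⟨i, p⟩ ⟨j, q⟩
  by_cases hij : i = j
  · subst hij
    rcases p with a | u <;> rcases q with b | u <;> simp [multiplier]
    exact congrFun (congrFun (h i) a) b
  · simp [multiplier, hij, Ne.symm hij]

/-- The multiplier is supported exactly on the blocks that the constraints fix to `I`. -/
theorem sdpObj_multiplier {Z : Matrix (Idx n d) (Idx n d) ℝ} (hZ : Z ∈ sdpFeasible n d) :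
    sdpObj (multiplier T G) Z = ∑ i, (multiplierBlock T G i).trace := by
  have hobj : sdpObj (multiplier T G) Z = ∑ q, ∑ p, multiplier T G p q * Z p q := by
    simp [sdpObj, Matrix.trace, Matrix.mul_apply]
  rw [hobj, Fintype.sum_prod_type]
  refine Finset.sum_congr rfl fun j _ => ?_
  have h1 : ∀ q, ∑ p, multiplier T G p (j, q) * Z p (j, q) =
      ∑ p, multiplier T G (j, p) (j, q) * Z (j, p) (j, q) := by
    intro q
    rw [Fintype.sum_prod_type, Finset.sum_eq_single j]
    · intro i _ hi; simp [multiplier, hi]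
    · simp
  simp only [h1]
  have h2 : ∀ a b, Z (j, Sum.inl a) (j, Sum.inl b) = (1 : Matrix (Fin d) (Fin d) ℝ) a b :=
    fun a b => congrFun (congrFun (hZ.2 j) a) b
  simp [multiplier, h2, Matrix.one_apply, Matrix.trace]

theorem sum_sq_transpose_mul {A B : Matrix (Fin d) (Fin d) ℝ} (hA : A * Aᵀ = 1) :
    ∑ a, ∑ b, (Aᵀ * B) a b ^ 2 = ∑ a, ∑ b, B a b ^ 2 := by
  have key : ∀ M : Matrix (Fin d) (Fin d) ℝ, ∑ a, ∑ b, M a b ^ 2 = (Mᵀ * M).trace := by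
    intro M
    simp only [Matrix.trace, Matrix.diag, Matrix.mul_apply, Matrix.transpose_apply, sq]
    exact Finset.sum_comm
  rw [key, key, Matrix.transpose_mul, Matrix.transpose_transpose, Matrix.mul_assoc,
    ← Matrix.mul_assoc A, hA, Matrix.one_mul]

/-- Multiplication by `Rᵢᵀ` preserves the Frobenius norm, and the translation columns of `G` are
dropped. Thus a small `G` forces a small multiplier, wherever the poses `T` lie. -/
theorem sum_sq_multiplier_le :
    ∑ p, ∑ q, multiplier T G p q ^ 2 ≤ ∑ a, ∑ p, G a p ^ 2 := by
  have h1 : ∑ p, ∑ q, multiplier T G p q ^ 2 =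
      ∑ i, ∑ a, ∑ b, multiplierBlock T G i a b ^ 2 := by
    rw [Fintype.sum_prod_type]
    refine Finset.sum_congr rfl fun i _ => ?_
    have : ∀ p, ∑ q, multiplier T G (i, p) q ^ 2 =
        ∑ q, multiplier T G (i, p) (i, q) ^ 2 := by
      intro p
      rw [Fintype.sum_prod_type, Finset.sum_eq_single i]
      · intro j _ hj; simp [multiplier, Ne.symm hj]
      · simp
    simp only [this]
    simp [multiplier]
  have h2 : ∑ a, ∑ p, G a p ^ 2 =
      ∑ i, ∑ a, (∑ b, G a (i, Sum.inl b) ^ 2 + G a (i, Sum.inr ()) ^ 2) := by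
    rw [Finset.sum_comm, Fintype.sum_prod_type]
    refine Finset.sum_congr rfl fun i _ => ?_
    rw [Finset.sum_comm]
    simp
  rw [h1, h2]
  refine Finset.sum_le_sum fun i _ => ?_
  rw [multiplierBlock, sum_sq_transpose_mul (Pose.R_mul_transpose (T i))]
  exact Finset.sum_le_sum fun a _ => le_add_of_nonneg_right (sq_nonneg _)

end PGO

/-! ### The dual certificate and exactness of the relaxation. -/

namespace PGO

variable {n d : ℕ}

theorem IsOptimal.mul_connLaplacian_inr {E : Finset (Fin n × Fin n)} {κ τ : Fin n → Fin n → ℝ}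
    {meas : Fin n → Fin n → Pose d} {T : Fin n → Pose d} (hT : IsOptimal E κ τ meas T)
    (hQ : (connLaplacian E κ τ meas)ᵀ = connLaplacian E κ τ meas) (a : Fin d) (i : Fin n) :
    (blockRow T * connLaplacian E κ τ meas) a (i, Sum.inr ()) = 0 := by
  have := hT.sum_eq_zero hQ i 0 (by simp) (Pi.single a 1)
  simpa [Pi.single_apply] using this

/-- Stationarity makes `L` orthogonal to skew matrices. Tested on its own skew part `A = L - Lᵀ`,
this yields `‖A‖_F² = 0`. -/
theorem IsOptimal.multiplierBlock_transpose {E : Finset (Fin n × Fin n)}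
    {κ τ : Fin n → Fin n → ℝ} {meas : Fin n → Fin n → Pose d} {T : Fin n → Pose d}
    (hT : IsOptimal E κ τ meas T)
    (hQ : (connLaplacian E κ τ meas)ᵀ = connLaplacian E κ τ meas) (i : Fin n) :
    (multiplierBlock T (blockRow T * connLaplacian E κ τ meas) i)ᵀ =
      multiplierBlock T (blockRow T * connLaplacian E κ τ meas) i := by
  set G := blockRow T * connLaplacian E κ τ meas
  set L := multiplierBlock T G i with hL
  set A := L - Lᵀ with hA
  have h := hT.sum_eq_zero hQ i A (by simp [hA]) 0
  have htr : ∀ M N : Matrix (Fin d) (Fin d) ℝ, (Mᵀ * N).trace = ∑ a, ∑ b, M a b * N a b := by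
    intro M N
    simp only [Matrix.trace, Matrix.diag, Matrix.mul_apply, Matrix.transpose_apply]
    exact Finset.sum_comm
  have h1 : (Aᵀ * L).trace = 0 := by
    have := htr ((T i).R * A) (G.submatrix id fun b => (i, Sum.inl b))
    rw [Matrix.transpose_mul, Matrix.mul_assoc] at this
    rw [hL, multiplierBlock, this]
    simpa using h
  have h2 : (Aᵀ * Lᵀ).trace = 0 := by
    rw [← Matrix.transpose_mul, Matrix.trace_transpose, Matrix.trace_mul_comm]
    have : Aᵀ = -A := by simp [hA]
    rw [this, Matrix.neg_mul, Matrix.trace_neg, neg_eq_zero] at h1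
    exact h1
  have h3 : (Aᴴ * A).trace = 0 := by
    rw [Matrix.conjTranspose_eq_transpose_of_trivial]
    nth_rewrite 2 [hA]
    rw [Matrix.mul_sub, Matrix.trace_sub, h1, h2, sub_zero]
  have h4 := Matrix.trace_conjTranspose_mul_self_eq_zero_iff.1 h3
  exact (sub_eq_zero.1 h4).symm

theorem transpose_mul_blockRow_mem_sdpFeasible (T : Fin n → Pose d) :
    (blockRow T)ᵀ * blockRow T ∈ sdpFeasible n d := by
  refine ⟨by simpa using Matrix.posSemidef_conjTranspose_mul_self (blockRow T), fun i => ?_⟩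
  rw [← Pose.R_transpose_mul (T i)]
  ext a b
  simp [Matrix.mul_apply, blockRow]

/-- The combination of the rows of `[R₁ t₁ ⋯ Rₙ tₙ]` and the translation direction which agrees
with `x` at pose `0`. -/
def anchored [NeZero n] (T : Fin n → Pose d) (x : Idx n d → ℝ) : Idx n d → ℝ :=
  let y := (T 0).R *ᵥ fun b => x (0, Sum.inl b)
  (blockRow T)ᵀ *ᵥ y + (x (0, Sum.inr ()) - (T 0).trans ⬝ᵥ y) • transOnes n d

theorem anchored_inl [NeZero n] (T : Fin n → Pose d) (x : Idx n d → ℝ) (i : Fin n) (b : Fin d) :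
    anchored T x (i, Sum.inl b) = (((T i).Rᵀ * (T 0).R) *ᵥ fun b => x (0, Sum.inl b)) b := by
  rw [← Matrix.mulVec_mulVec, anchored]
  generalize (T 0).R *ᵥ _ = y
  simp [ transOnes, Matrix.mulVec, dotProduct, blockRow]

theorem anchored_inr [NeZero n] (T : Fin n → Pose d) (x : Idx n d → ℝ) (i : Fin n) :
    anchored T x (i, Sum.inr ()) = x (0, Sum.inr ()) +
      ((T i).trans - (T 0).trans) ⬝ᵥ ((T 0).R *ᵥ fun b => x (0, Sum.inl b)) := by
  rw [sub_dotProduct, anchored]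
  generalize (T 0).R *ᵥ _ = y
  simp [ transOnes, Matrix.mulVec, dotProduct, blockRow]
  ring

theorem anchored_zero [NeZero n] (T : Fin n → Pose d) (x : Idx n d → ℝ) (s : Fin d ⊕ Unit) :
    anchored T x (0, s) = x (0, s) := by
  rcases s with b | u
  · rw [anchored_inl, Pose.R_transpose_mul, Matrix.one_mulVec]
  · rw [anchored_inr, sub_self, zero_dotProduct, add_zero]

section Certificate

variable [NeZero n] {S : Matrix (Idx n d) (Idx n d) ℝ} {T : Fin n → Pose d}

theorem mulVec_anchored (hS : Sᵀ = S) (hX : blockRow T * S = 0) (he : S *ᵥ transOnes n d = 0)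
    (x : Idx n d → ℝ) : S *ᵥ anchored T x = 0 := by
  have : S * (blockRow T)ᵀ = 0 := by
    rw [← Matrix.transpose_inj, Matrix.transpose_mul, Matrix.transpose_transpose, hS, hX,
      Matrix.transpose_zero]
  rw [anchored, Matrix.mulVec_add, Matrix.mulVec_mulVec, this, Matrix.zero_mulVec,
    Matrix.mulVec_smul, he, smul_zero, add_zero]

/-- A symmetric matrix annihilating `[R₁ t₁ ⋯ Rₙ tₙ]` and the translation direction which is positive
on vectors vanishing at pose `0` is positive semidefinite. -/
theorem posSemidef_of_annihilates (hS : Sᵀ = S) (hX : blockRow T * S = 0)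
    (he : S *ᵥ transOnes n d = 0)
    (hpos : ∀ v : Idx n d → ℝ, (∀ s, v (0, s) = 0) → v ≠ 0 → 0 < v ⬝ᵥ S *ᵥ v) :
    S.PosSemidef := by
  refine Matrix.PosSemidef.of_dotProduct_mulVec_nonneg (by simpa [Matrix.IsHermitian] using hS)
    fun x => ?_
  rw [star_trivial, ← Matrix.dotProduct_mulVec_sub hS x _ (mulVec_anchored hS hX he x)]
  by_cases hv : x - anchored T x = 0
  · simp [hv]
  · exact (hpos _ (by simp [anchored_zero]) hv).le

/-- The difference of the two sides is a null vector of `S` vanishing at pose `0`, so positivity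
forces it to be zero. -/
theorem eq_anchored_of_mulVec_eq_zero (hS : Sᵀ = S) (hX : blockRow T * S = 0)
    (he : S *ᵥ transOnes n d = 0)
    (hpos : ∀ v : Idx n d → ℝ, (∀ s, v (0, s) = 0) → v ≠ 0 → 0 < v ⬝ᵥ S *ᵥ v)
    (x : Idx n d → ℝ) (hx : S *ᵥ x = 0) : x = anchored T x := by
  by_contra hne
  have := hpos (x - anchored T x) (by simp [anchored_zero]) (sub_ne_zero.2 hne)
  rw [Matrix.mulVec_sub, hx, mulVec_anchored hS hX he, sub_zero, dotProduct_zero] at this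
  exact this.false

end Certificate

theorem sdpObj_nonneg {S Z : Matrix (Idx n d) (Idx n d) ℝ} (hS : S.PosSemidef)
    (hZ : Z.PosSemidef) : 0 ≤ sdpObj S Z := by
  have hT : Sᵀ = S := by simpa using hS.isHermitian.eq
  obtain ⟨B, rfl⟩ := hZ.exists_eq_transpose_mul_self
  rw [sdpObj_transpose_mul S hT, trace_mul_mul_transpose]
  exact Finset.sum_nonneg fun a _ => by simpa using hS.dotProduct_mulVec_nonneg (B a)

/-- Complementary slackness: with `Z = Bᵀ B`, every row of `B` has zero `S`-form and so lies in the
kernel of `S ⪰ 0`. -/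
theorem mul_eq_zero_of_sdpObj_eq_zero {S Z : Matrix (Idx n d) (Idx n d) ℝ} (hS : S.PosSemidef)
    (hZ : Z.PosSemidef) (h : sdpObj S Z = 0) : S * Z = 0 := by
  have hT : Sᵀ = S := by simpa using hS.isHermitian.eq
  obtain ⟨B, rfl⟩ := hZ.exists_eq_transpose_mul_self
  rw [sdpObj_transpose_mul S hT, trace_mul_mul_transpose, Finset.sum_eq_zero_iff_of_nonneg
    (fun a _ => by simpa using hS.dotProduct_mulVec_nonneg (B a))] at h
  have hB : S * Bᵀ = 0 := by
    ext p a
    have := (hS.dotProduct_mulVec_zero_iff (B a)).1 (by simpa using h a (Finset.mem_univ a))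
    simpa [Matrix.mul_apply, Matrix.mulVec, dotProduct] using congrFun this p
  rw [← Matrix.mul_assoc, hB, Matrix.zero_mul]

/-- The action of the rigid motion `x ↦ g (x - c) + w` on poses. -/
def moved (g : Matrix.specialOrthogonalGroup (Fin d) ℝ) (c w : Fin d → ℝ) (T : Fin n → Pose d) :
    Fin n → Pose d :=
  fun i => ⟨g * (T i).rot, g.1 *ᵥ ((T i).trans - c) + w⟩

/-- Gauge invariance: `c` and `w` cancel in each residual, which is only multiplied by the isometry
`g`. -/
theorem cost_moved (E : Finset (Fin n × Fin n)) (κ τ : Fin n → Fin n → ℝ)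
    (meas : Fin n → Fin n → Pose d) (g : Matrix.specialOrthogonalGroup (Fin d) ℝ)
    (c w : Fin d → ℝ) (T : Fin n → Pose d) :
    cost E κ τ meas (moved g c w T) = cost E κ τ meas T := by
  have hg : g.1ᵀ * g.1 = 1 := Pose.R_transpose_mul ⟨g, 0⟩
  have hfrob : ∀ M : Matrix (Fin d) (Fin d) ℝ, frobSq (g.1 * M) = frobSq M := by
    intro M
    have := sum_sq_transpose_mul (A := g.1ᵀ) (B := M) (by rwa [Matrix.transpose_transpose])
    rwa [Matrix.transpose_transpose] at this
  have hnorm : ∀ v : Fin d → ℝ, normSq (g.1 *ᵥ v) = normSq v := by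
    have key : ∀ v : Fin d → ℝ, normSq v = v ⬝ᵥ v := fun v => by
      simp [normSq, dotProduct, sq]
    intro v
    rw [key, key, Matrix.dotProduct_mulVec, ← Matrix.mulVec_transpose, Matrix.mulVec_mulVec, hg,
      Matrix.one_mulVec]
  refine Finset.sum_congr rfl fun e _ => ?_
  have hR : ∀ i, (moved g c w T i).R = g.1 * (T i).R := fun i => rfl
  have ht : ∀ i, (moved g c w T i).trans = g.1 *ᵥ ((T i).trans - c) + w := fun i => rfl
  have h1 : (moved g c w T e.2).R - (moved g c w T e.1).R * (meas e.1 e.2).R =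
      g.1 * ((T e.2).R - (T e.1).R * (meas e.1 e.2).R) := by
    rw [hR, hR, Matrix.mul_sub, Matrix.mul_assoc]
  have h2 : (moved g c w T e.2).trans - (moved g c w T e.1).trans -
      (moved g c w T e.1).R *ᵥ (meas e.1 e.2).trans =
      g.1 *ᵥ ((T e.2).trans - (T e.1).trans - (T e.1).R *ᵥ (meas e.1 e.2).trans) := by
    rw [ht, ht, hR, Matrix.mulVec_sub, Matrix.mulVec_sub, Matrix.mulVec_sub, Matrix.mulVec_sub,
      Matrix.mulVec_mulVec]
    abel
  rw [h1, h2, hfrob, hnorm]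

/-- If the dual certificate `Q - multiplier` is positive off pose `0`, the relaxation is exact. -/
theorem exact_of_certificate [NeZero n] (E : Finset (Fin n × Fin n)) (κ τ : Fin n → Fin n → ℝ)
    (meas : Fin n → Fin n → Pose d) {T : Fin n → Pose d} (hT : IsOptimal E κ τ meas T)
    (hQ : (connLaplacian E κ τ meas)ᵀ = connLaplacian E κ τ meas)
    (hpos : ∀ v : Idx n d → ℝ, (∀ s, v (0, s) = 0) → v ≠ 0 →
      0 < v ⬝ᵥ (connLaplacian E κ τ meas -
        multiplier T (blockRow T * connLaplacian E κ τ meas)) *ᵥ v) :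
    (∃ Z, IsSDPMinimizer (connLaplacian E κ τ meas) Z) ∧
      ∀ Z, IsSDPMinimizer (connLaplacian E κ τ meas) Z →
        ∃ T : Fin n → Pose d, IsOptimal E κ τ meas T ∧ firstRows Z = blockRow T ∧
          sdpObj (connLaplacian E κ τ meas) Z = cost E κ τ meas T := by
  set Q := connLaplacian E κ τ meas
  set L := multiplier T (blockRow T * Q) with hL
  set S := Q - L with hSdef
  have hLT : Lᵀ = L := multiplier_transpose _ _ (hT.multiplierBlock_transpose hQ)
  have hS : Sᵀ = S := by rw [hSdef, Matrix.transpose_sub, hQ, hLT]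
  have hX : blockRow T * S = 0 := by
    rw [hSdef, Matrix.mul_sub, hL, blockRow_mul_multiplier _ _ (hT.mul_connLaplacian_inr hQ),
      sub_self]
  have he : S *ᵥ transOnes n d = 0 := by
    rw [hSdef, Matrix.sub_mulVec, connLaplacian_mulVec_transOnes, hL, multiplier_mulVec_transOnes,
      sub_self]
  have hSpos : S.PosSemidef := posSemidef_of_annihilates hS hX he hpos
  have hobj : ∀ Z ∈ sdpFeasible n d, sdpObj Q Z =
      sdpObj S Z + ∑ i, (multiplierBlock T (blockRow T * Q) i).trace := by
    intro Z hZ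
    rw [← sdpObj_multiplier T (blockRow T * Q) hZ, hSdef]
    simp only [sdpObj, Matrix.transpose_sub, Matrix.sub_mul, Matrix.trace_sub]
    rw [hL]
    ring
  set Z₀ := (blockRow T)ᵀ * blockRow T
  have hZ₀ : Z₀ ∈ sdpFeasible n d := transpose_mul_blockRow_mem_sdpFeasible T
  have hS0 : sdpObj S Z₀ = 0 := by
    rw [sdpObj_transpose_mul S hS, hX, Matrix.zero_mul, Matrix.trace_zero]
  have hmin : IsSDPMinimizer Q Z₀ := by
    refine ⟨hZ₀, fun Z hZ => ?_⟩
    change sdpObj Q Z₀ ≤ sdpObj Q Z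
    rw [hobj _ hZ₀, hobj _ hZ, hS0]
    gcongr
    exact sdpObj_nonneg hSpos hZ.1
  refine ⟨⟨Z₀, hmin⟩, fun Z hZ => ?_⟩
  have hval : sdpObj Q Z = sdpObj Q Z₀ := le_antisymm (hZ.2 hZ₀) (hmin.2 hZ.1)
  have hSZ : S * Z = 0 := by
    refine mul_eq_zero_of_sdpObj_eq_zero hSpos hZ.1.1 ?_
    have := hobj Z hZ.1
    rw [hval, hobj _ hZ₀, hS0] at this
    linarith
  have hcol : ∀ q, (fun p => Z p q) = anchored T fun p => Z p q := by
    intro q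
    refine eq_anchored_of_mulVec_eq_zero hS hX he hpos _ ?_
    ext p
    simpa [Matrix.mul_apply, Matrix.mulVec, dotProduct] using congrFun (congrFun hSZ p) q
  have hsymm : ∀ p q, Z p q = Z q p := fun p q => by
    simpa using (hZ.1.1.isHermitian.apply q p)
  have hrot : ∀ a : Fin d, (fun b : Fin d => Z (0, Sum.inl b) (0, Sum.inl a)) = Pi.single a 1 := by
    intro a
    ext b
    have := congrFun (congrFun (hZ.1.2 0) b) a
    rw [Matrix.submatrix_apply] at this
    rw [this, Matrix.one_apply, Pi.single_apply]
  -- The constraint at block `0` makes the first rotation `I`, hence the motion by `R₀ᵀ`. The first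
  -- translation is not constrained, so it is read off from `Z`.
  refine ⟨moved (T 0).rot⁻¹ (T 0).trans (fun a => Z (0, Sum.inr ()) (0, Sum.inl a)) T,
    fun T' => ?_, ?_, ?_⟩
  · rw [cost_moved]; exact hT T'
  · have hginv : ((T 0).rot⁻¹).1 = (T 0).Rᵀ := rfl
    ext a ⟨i, b | u⟩
    · change Z (0, Sum.inl a) (i, Sum.inl b) = (((T 0).rot⁻¹).1 * (T i).R) a b
      rw [hsymm, congrFun (hcol (0, Sum.inl a)) (i, Sum.inl b), anchored_inl, hrot, hginv,
        Matrix.mulVec_single_one]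
      simp [Matrix.mul_apply, mul_comm]
    · change Z (0, Sum.inl a) (i, Sum.inr ()) =
        (((T 0).rot⁻¹).1 *ᵥ ((T i).trans - (T 0).trans)) a + Z (0, Sum.inr ()) (0, Sum.inl a)
      rw [hsymm, congrFun (hcol (0, Sum.inl a)) (i, Sum.inr ()), anchored_inr, hrot, hginv,
        Matrix.mulVec_single_one, add_comm]
      simp [Matrix.mulVec, dotProduct, mul_comm]
  · rw [cost_moved, hval, sdpObj_transpose_mul Q hQ, cost_eq_trace]

end PGO

/-! ### Noise estimates and the choice of `δ`. -/

namespace PGO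

variable {n d : ℕ}

theorem sum_sq_mul_connLaplacian_le (E : Finset (Fin n × Fin n)) (κ τ : Fin n → Fin n → ℝ)
    (meas : Fin n → Fin n → Pose d) (hQ : (connLaplacian E κ τ meas).PosSemidef) {M : ℝ}
    (hM : 0 < M) (hQM : ∀ y, y ⬝ᵥ connLaplacian E κ τ meas *ᵥ y ≤ M * (y ⬝ᵥ y))
    (T : Fin n → Pose d) :
    ∑ a, ∑ p, (blockRow T * connLaplacian E κ τ meas) a p ^ 2 ≤ M * cost E κ τ meas T := by
  have hT : (connLaplacian E κ τ meas)ᵀ = connLaplacian E κ τ meas := by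
    simpa using hQ.isHermitian.eq
  rw [cost_eq_trace, trace_mul_mul_transpose, Finset.mul_sum]
  refine Finset.sum_le_sum fun a _ => ?_
  have h := hQ.dotProduct_mulVec_self_le hM hQM (blockRow T a)
  have hrow : (blockRow T * connLaplacian E κ τ meas) a =
      connLaplacian E κ τ meas *ᵥ blockRow T a := by
    conv_rhs => rw [← hT, Matrix.mulVec_transpose]
    rfl
  rw [hrow]
  simpa [dotProduct, sq] using h

/-- The cost is linear in the Laplacian and the true poses have zero noiseless cost, so only the
perturbation contributes. -/
theorem cost_truth_le (E : Finset (Fin n × Fin n)) (κ τ : Fin n → Fin n → ℝ)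
    (meas : Fin n → Fin n → Pose d) (truth : Fin n → Pose d) :
    cost E κ τ meas truth ≤ specNorm (connLaplacian E κ τ meas -
      connLaplacian E κ τ (fun i j => (truth i).rel (truth j))) *
        ∑ a, blockRow truth a ⬝ᵥ blockRow truth a := by
  have h0 := cost_rel_eq_zero E κ τ truth
  rw [cost_eq_trace, trace_mul_mul_transpose] at h0
  rw [cost_eq_trace, trace_mul_mul_transpose, ← sub_zero (∑ a, _), ← h0,
    ← Finset.sum_sub_distrib, Finset.mul_sum]
  refine Finset.sum_le_sum fun a _ => ?_
  rw [← dotProduct_sub, ← Matrix.sub_mulVec]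
  exact (le_abs_self _).trans (abs_dotProduct_mulVec_le_specNorm _ _)

end PGO

theorem theorem2 {n d : ℕ} [NeZero n]
    (E : Finset (Fin n × Fin n)) (hE : PGO.WeaklyConnected E)
    (κ τ : Fin n → Fin n → ℝ)
    (hκ : ∀ e ∈ E, 0 < κ e.1 e.2) (hτ : ∀ e ∈ E, 0 < τ e.1 e.2)
    (truth : Fin n → Pose d) :
    ∃ δ : ℝ, 0 < δ ∧ ∀ meas : Fin n → Fin n → Pose d,
      PGO.specNorm (PGO.connLaplacian E κ τ meas -
          PGO.connLaplacian E κ τ (fun i j => (truth i).rel (truth j))) < δ →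
        (∃ Z, PGO.IsSDPMinimizer (PGO.connLaplacian E κ τ meas) Z) ∧
        ∀ Z, PGO.IsSDPMinimizer (PGO.connLaplacian E κ τ meas) Z →
          ∃ T : Fin n → Pose d, PGO.IsOptimal E κ τ meas T ∧
            PGO.firstRows Z = PGO.blockRow T ∧
            PGO.sdpObj (PGO.connLaplacian E κ τ meas) Z = PGO.cost E κ τ meas T := by
  set Q₀ := PGO.connLaplacian E κ τ (fun i j => (truth i).rel (truth j)) with hQ₀
  obtain ⟨c, hc, hcoer⟩ := PGO.exists_pos_mul_le_dotProduct_connLaplacian E κ τ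
    (fun i j => (truth i).rel (truth j)) hE hκ hτ
  set N := ∑ a, PGO.blockRow truth a ⬝ᵥ PGO.blockRow truth a with hN
  have hN0 : 0 ≤ N := Finset.sum_nonneg fun a _ => Finset.sum_nonneg fun p _ => mul_self_nonneg _
  set M := PGO.specNorm Q₀ + 1 with hM
  have hM0 : 0 < M := by have := PGO.specNorm_nonneg Q₀; linarith
  have hMN : 0 < 4 * (M * N + 1) := by positivity
  -- The bound `1` gives `Q ⪯ M`; `c / 4` limits the loss from `Q - Q₀`; the last makes `M ε N ≤ (c
  -- / 2)²`, with `+ 1` keeping the denominator positive when `N = 0`.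
  refine ⟨min 1 (min (c / 4) (c ^ 2 / (4 * (M * N + 1)))), by positivity, fun meas hmeas => ?_⟩
  set Q := PGO.connLaplacian E κ τ meas with hQdef
  set ε := PGO.specNorm (Q - Q₀) with hε
  have hε0 : 0 ≤ ε := PGO.specNorm_nonneg _
  obtain ⟨hε1, hε2, hε3⟩ : ε < 1 ∧ ε < c / 4 ∧ ε < c ^ 2 / (4 * (M * N + 1)) := by
    simpa using hmeas
  have hQ : Q.PosSemidef := PGO.connLaplacian_posSemidef E κ τ meas hκ hτ
  have hQT : Qᵀ = Q := by simpa using hQ.isHermitian.eq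
  have hself : ∀ y : PGO.Idx n d → ℝ, 0 ≤ y ⬝ᵥ y := fun y =>
    Finset.sum_nonneg fun p _ => mul_self_nonneg _
  have hdiff : ∀ y : PGO.Idx n d → ℝ, |y ⬝ᵥ Q *ᵥ y - y ⬝ᵥ Q₀ *ᵥ y| ≤ ε * (y ⬝ᵥ y) := fun y => by
    rw [← dotProduct_sub, ← Matrix.sub_mulVec]
    exact PGO.abs_dotProduct_mulVec_le_specNorm _ _
  have hQM : ∀ y, y ⬝ᵥ Q *ᵥ y ≤ M * (y ⬝ᵥ y) := by
    intro y
    have h1 := (abs_le.1 (hdiff y)).2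
    have h2 := (abs_le.1 (PGO.abs_dotProduct_mulVec_le_specNorm Q₀ y)).2
    have h3 := mul_le_mul_of_nonneg_right hε1.le (hself y)
    rw [hM]
    linarith
  obtain ⟨T, hT⟩ := PGO.exists_isOptimal E κ τ meas hκ hτ
  refine PGO.exact_of_certificate E κ τ meas hT hQT fun v hv0 hv => ?_
  have hvpos : 0 < v ⬝ᵥ v := (hself v).lt_of_ne' fun h => hv (dotProduct_self_eq_zero.1 h)
  have hG : ∑ a, ∑ p, (PGO.blockRow T * Q) a p ^ 2 ≤ (c / 2) ^ 2 := by
    have h1 := PGO.sum_sq_mul_connLaplacian_le E κ τ meas hQ hM0 hQM T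
    have h2 : PGO.cost E κ τ meas T ≤ ε * N :=
      (hT truth).trans (PGO.cost_truth_le E κ τ meas truth)
    have h3 := mul_le_mul_of_nonneg_left h2 hM0.le
    rw [lt_div_iff₀ hMN] at hε3
    have h4 : M * (ε * N) ≤ (c / 2) ^ 2 := by nlinarith
    exact (h1.trans h3).trans h4
  set L := PGO.multiplier T (PGO.blockRow T * Q)
  have hL : v ⬝ᵥ L *ᵥ v ≤ c / 2 * (v ⬝ᵥ v) := by
    refine le_of_sq_le_sq ?_ (by positivity)
    rw [mul_pow]
    refine (Matrix.sq_dotProduct_mulVec_le L v).trans ?_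
    gcongr
    exact (PGO.sum_sq_multiplier_le T _).trans hG
  have h1 := (abs_le.1 (hdiff v)).1
  have h2 := hcoer v hv0
  have h3 := mul_lt_mul_of_pos_right hε2 hvpos
  rw [Matrix.sub_mulVec, dotProduct_sub]
  have h4 : 0 < c * (v ⬝ᵥ v) := by positivity
  -- The certificate form is at least `(c - ε - c / 2) ‖v‖²`, which exceeds `(c / 4) ‖v‖²`.
  linarith
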